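/- Let $(X,\mathcal A,\mu)$ be an arbitrary measure space (not assumed complete or $\sigma$-finite), let $m\in\mathbb N$, and let $F$ be a set-valued map that assigns to each $x\in X$ a nonempty compact convex set $F(x)\subset\mathbb R^m$ and is measurable, i.e. $\{x\in X: F(x)\cap U\neq\emptyset\}\in\mathcal A$ for every open $U\subset\mathbb R^m$. Let $f\in L^1(X,\mu;\mathbb R^m)$ be such that $f(x)$ is an extreme point of $F(x)$ for $\mu$-a.e. $x\in X$, and let $(f_n)_{n\in\mathbb N}$ be a sequence in $L^1(X,\mu;\mathbb R^m)$ such that, for every $n$, $f_n(x)\in F(x)$ for $\mu$-a.e. $x\in X$. If $f_n\rightharpoonup f$ weakly in $L^1(X,\mu;\mathbb R^m)$, i.e. in the weak topology induced by the full topological dual of $L^1(X,\mu;\mathbb R^m)$, then $f_n\to f$ in the norm of $L^1(X,\mu;\mathbb R^m)$. -/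

import Mathlib

open MeasureTheory Filter Topology

/-- A set-valued map `F` from a measurable space to a topological space is measurable if the
inverse image `{x | F x ∩ U ≠ ∅}` of every open set `U` is measurable. -/
def MeasurableSetValued {X Y : Type*} [MeasurableSpace X] [TopologicalSpace Y]
    (F : X → Set Y) : Prop :=
  ∀ U : Set Y, IsOpen U → MeasurableSet {x | (F x ∩ U).Nonempty}

/-! Put g_n = f_n - f. Extremality of f(x) makes |y - f(x)| at most ε plus a linear form in y - f(x)
on F(x). With ε replaced by an integrable weight and the slope by a bounded measurable field,
integration bounds the L¹ norm, since weak convergence kills the linear term. Slopes from a dense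
sequence cut X, up to a null set, into countably many measurable pieces; finite unions have bounded
slopes. A gliding hump (`eventually_integral_norm_le_of_exhaustion`) controls the rest. Only bounded
test functions occur, so σ-finiteness is not needed. -/

/-- In finite dimension, the convex hull of a compact set is compact. -/
theorem IsCompact.isCompact_convexHull_of_finiteDimensional {E : Type*} [NormedAddCommGroup E]
    [NormedSpace ℝ E] [FiniteDimensional ℝ E] {s : Set E} (hs : IsCompact s) :
    IsCompact (convexHull ℝ s) := by
  let T : (k : ℕ) → (Fin k → ℝ) × (Fin k → E) → E := fun k q => ∑ i, q.1 i • q.2 i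
  let C : (k : ℕ) → Set ((Fin k → ℝ) × (Fin k → E)) :=
    fun k => stdSimplex ℝ (Fin k) ×ˢ Set.univ.pi fun _ => s
  have hT : ∀ k, Continuous (T k) := fun k => by fun_prop
  have hC : ∀ k, IsCompact (C k) := fun k =>
    (isCompact_stdSimplex ℝ (Fin k)).prod (isCompact_univ_pi fun _ => hs)
  -- Carathéodory: `finrank + 1` points suffice, and `range` excludes its bound.
  have hunion : convexHull ℝ s =
      ⋃ k ∈ Finset.range (Module.finrank ℝ E + 2), T k '' C k := by
    apply Set.Subset.antisymm
    · intro x hx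
      obtain ⟨ι, _, z, w, hz, hind, hw, hw1, hwx⟩ := eq_pos_convex_span_of_mem_convexHull hx
      let e := Fintype.equivFin ι
      have hcard : Fintype.card ι ≤ Module.finrank ℝ E + 1 :=
        hind.card_le_finrank_succ.trans (by gcongr; exact Submodule.finrank_le _)
      simp only [Set.mem_iUnion, Finset.mem_range]
      refine ⟨Fintype.card ι, by omega, (fun i => w (e.symm i), fun i => z (e.symm i)),
        ⟨⟨fun i => (hw _).le, ?_⟩, fun i _ => hz ⟨_, rfl⟩⟩, ?_⟩
      · rw [← hw1]; exact e.symm.sum_comp w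
      · rw [← hwx]; exact e.symm.sum_comp fun i => w i • z i
    · refine Set.iUnion₂_subset fun k _ => ?_
      rintro _ ⟨⟨w, z⟩, ⟨hw, hz⟩, rfl⟩
      exact (convex_convexHull ℝ s).sum_mem (fun i _ => hw.1 i) hw.2
        fun i _ => subset_convexHull ℝ s (hz i trivial)
  rw [hunion]
  exact (Finset.range _).isCompact_biUnion fun k _ => (hC k).image (hT k)

/-- Near an extreme point `e` of a compact convex set `K`, the distance to `e` is dominated on all
of `K` by an affine function whose value at `e` is as small as we please. -/
theorem exists_norm_sub_lt_add_inner_of_mem_extremePoints {E : Type*} [NormedAddCommGroup E]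
    [InnerProductSpace ℝ E] [FiniteDimensional ℝ E] {K : Set E} (hK : IsCompact K)
    (hconv : Convex ℝ K) {e : E} (he : e ∈ Set.extremePoints ℝ K) {ε : ℝ} (hε : 0 < ε) :
    ∃ p : E, ∀ y ∈ K, ‖y - e‖ < ε + inner ℝ p (y - e) := by
  let G : Set (E × ℝ) := convexHull ℝ ((fun y => (y, ‖y - e‖)) '' K)
  have hG : IsCompact G :=
    (hK.image (by fun_prop)).isCompact_convexHull_of_finiteDimensional
  have hmem : ∀ y ∈ K, (y, ‖y - e‖) ∈ G := fun y hy => subset_convexHull ℝ _ ⟨y, hy, rfl⟩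
  -- Extremality enters here: the hull of the graph of the distance meets the fibre over `e` only at
  -- height 0.
  have hQ : Convex ℝ {q : E × ℝ | q.1 ∈ K ∧ (q.1 = e → q.2 = 0)} := by
    rw [convex_iff_forall_pos]
    rintro ⟨y, s⟩ ⟨hy, hs⟩ ⟨z, t⟩ ⟨hz, ht⟩ a b ha hb hab
    refine ⟨hconv hy hz ha.le hb.le hab, fun h => ?_⟩
    have hye := he.2 hy hz ⟨a, b, ha, hb, hab, h⟩
    have hze := he.2 hz hy ⟨b, a, hb, ha, by rw [add_comm]; exact hab, by
      rw [add_comm]; exact h⟩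
    simp only at hs ht hye hze
    simp [hs hye, ht hze]
  have hGQ : G ⊆ {q : E × ℝ | q.1 ∈ K ∧ (q.1 = e → q.2 = 0)} := by
    refine convexHull_min ?_ hQ
    rintro _ ⟨y, hy, rfl⟩
    exact ⟨hy, fun h => by simp_all⟩
  have hdisj : Disjoint G ({e} ×ˢ Set.Ici ε) := by
    rw [Set.disjoint_left]
    rintro ⟨y, t⟩ hq ⟨hy, ht⟩
    have := (hGQ hq).2 hy
    simp only [Set.mem_Ici] at this ht
    linarith
  obtain ⟨L, u, v, hu, huv, hv⟩ := geometric_hahn_banach_compact_closed (convex_convexHull ℝ _) hG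
    ((convex_singleton e).prod (convex_Ici ε)) (isClosed_singleton.prod isClosed_Ici) hdisj
  let c : ℝ := L (0, 1)
  have hL : ∀ y t, L (y, t) = L (e, 0) + L (y - e, 0) + t * c := fun y t => by
    have : (y, t) = (e, (0 : ℝ)) + (y - e, (0 : ℝ)) + t • ((0 : E), (1 : ℝ)) := by simp
    rw [this, map_add, map_add, map_smul, smul_eq_mul]
  have h0 := hu _ (hmem e he.1)
  have h1 := hv (e, ε) ⟨rfl, le_refl ε⟩
  rw [hL] at h0 h1
  simp only [sub_self, norm_zero, zero_mul, Prod.mk_zero_zero, map_zero, add_zero] at h0 h1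
  -- The separating hyperplane is not vertical, so it can be solved for the height.
  have hc : 0 < c := by
    by_contra! h
    nlinarith
  let ℓ : StrongDual ℝ E := L.comp (ContinuousLinearMap.inl ℝ E ℝ)
  refine ⟨-(c⁻¹ • (InnerProductSpace.toDual ℝ E).symm ℓ), fun y hy => ?_⟩
  have h2 := hu _ (hmem y hy)
  rw [hL] at h2
  rw [inner_neg_left, real_inner_smul_left, InnerProductSpace.toDual_symm_apply]
  have hℓ : ℓ (y - e) = L (y - e, 0) := rfl
  rw [hℓ]
  have h3 : L (y - e, 0) + ‖y - e‖ * c < ε * c := by linarith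
  have h4 : c⁻¹ * L (y - e, 0) * c = L (y - e, 0) := by field_simp
  nlinarith

/-- The slope in `exists_norm_sub_lt_add_inner_of_mem_extremePoints` can be taken in any dense
sequence. -/
theorem exists_norm_sub_le_add_inner_of_denseRange {E : Type*} [NormedAddCommGroup E]
    [InnerProductSpace ℝ E] [FiniteDimensional ℝ E] {K : Set E} (hK : IsCompact K)
    (hconv : Convex ℝ K) {e : E} (he : e ∈ Set.extremePoints ℝ K) {ε : ℝ} (hε : 0 < ε)
    {p : ℕ → E} (hp : DenseRange p) :
    ∃ k, ∀ y ∈ K, ‖y - e‖ ≤ ε + inner ℝ (p k) (y - e) := by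
  obtain ⟨q, hq⟩ := exists_norm_sub_lt_add_inner_of_mem_extremePoints hK hconv he (half_pos hε)
  obtain ⟨R, hR⟩ := hK.isBounded.subset_closedBall e
  have hR' : ∀ y ∈ K, ‖y - e‖ ≤ R := fun y hy => by simpa [dist_eq_norm] using hR hy
  have hR0 : 0 ≤ R := (norm_nonneg _).trans (hR' e he.1)
  obtain ⟨k, hk⟩ := hp.exists_dist_lt q (ε := ε / 2 / (R + 1)) (by positivity)
  refine ⟨k, fun y hy => ?_⟩
  have h1 := hq y hy
  have h2 : inner ℝ q (y - e) = inner ℝ (p k) (y - e) + inner ℝ (q - p k) (y - e) := by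
    rw [inner_sub_left]; ring
  have h3 : inner ℝ (q - p k) (y - e) ≤ ε / 2 / (R + 1) * (R + 1) := by
    refine (real_inner_le_norm _ _).trans ?_
    rw [dist_eq_norm] at hk
    gcongr
    linarith [hR' y hy]
  rw [div_mul_cancel₀ _ (by positivity)] at h3
  linarith

/-! ### Weak convergence and the gliding hump -/

theorem MeasureTheory.Integrable.inner_of_bounded {X E : Type*} [MeasurableSpace X]
    {μ : Measure X} [NormedAddCommGroup E] [InnerProductSpace ℝ E] [MeasurableSpace E]
    [BorelSpace E] [SecondCountableTopology E] {φ g : X → E} (hφ : Measurable φ) {C : ℝ}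
    (hC : ∀ x, ‖φ x‖ ≤ C) (hg : Integrable g μ) :
    Integrable (fun x => (inner ℝ (φ x) (g x) : ℝ)) μ := by
  refine (hg.norm.const_mul C).mono' (hφ.aestronglyMeasurable.inner hg.1)
    (Eventually.of_forall fun x => ?_)
  exact (norm_inner_le_norm _ _).trans (by gcongr; exact hC x)

/-- A weakly convergent sequence in `L¹` converges when tested against bounded measurable
functions. -/
theorem tendsto_integral_inner_sub_of_tendsto_toWeakSpace {X E : Type*} [MeasurableSpace X]
    {μ : Measure X} [NormedAddCommGroup E] [InnerProductSpace ℝ E] [MeasurableSpace E]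
    [BorelSpace E] [SecondCountableTopology E] {f : Lp E 1 μ} {fseq : ℕ → Lp E 1 μ}
    (hweak : Tendsto (fun n => toWeakSpace ℝ (Lp E 1 μ) (fseq n)) atTop
      (𝓝 (toWeakSpace ℝ (Lp E 1 μ) f)))
    {φ : X → E} (hφ : Measurable φ) {C : ℝ} (hC : ∀ x, ‖φ x‖ ≤ C) :
    Tendsto (fun n => ∫ x, (inner ℝ (φ x) (fseq n x - f x) : ℝ) ∂μ) atTop (𝓝 0) := by
  have hint : ∀ g : Lp E 1 μ, Integrable (fun x => (inner ℝ (φ x) (g x) : ℝ)) μ := fun g =>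
    (L1.integrable_coeFn g).inner_of_bounded hφ hC
  let A : Lp E 1 μ →ₗ[ℝ] ℝ :=
    { toFun := fun g => ∫ x, (inner ℝ (φ x) (g x) : ℝ) ∂μ
      map_add' := fun g h => by
        rw [← integral_add (hint g) (hint h)]
        refine integral_congr_ae ?_
        filter_upwards [Lp.coeFn_add g h] with x hx
        rw [hx, Pi.add_apply, inner_add_right]
      map_smul' := fun c g => by
        rw [RingHom.id_apply, smul_eq_mul, ← integral_const_mul]
        refine integral_congr_ae ?_
        filter_upwards [Lp.coeFn_smul c g] with x hx
        rw [hx, Pi.smul_apply, real_inner_smul_right] }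
  have hA : ∀ g, ‖A g‖ ≤ C * ‖g‖ := fun g => by
    rw [L1.norm_eq_integral_norm, ← integral_const_mul]
    refine norm_integral_le_of_norm_le ((L1.integrable_coeFn g).norm.const_mul C)
      (Eventually.of_forall fun x => ?_)
    exact (norm_inner_le_norm _ _).trans (by gcongr; exact hC x)
  let A' : StrongDual ℝ (Lp E 1 μ) := A.mkContinuous C hA
  have h1 : Tendsto (fun n => A' (fseq n)) atTop (𝓝 (A' f)) :=
    ((WeakBilin.eval_continuous (topDualPairing ℝ (Lp E 1 μ)).flip A').tendsto _).comp hweak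
  have h2 : Tendsto (fun n => A' (fseq n) - A' f) atTop (𝓝 0) := by
    simpa using h1.sub_const (A' f)
  refine h2.congr fun n => ?_
  change (∫ x, (inner ℝ (φ x) (fseq n x) : ℝ) ∂μ) - ∫ x, (inner ℝ (φ x) (f x) : ℝ) ∂μ = _
  rw [← integral_sub (hint _) (hint _)]
  simp only [inner_sub_right]

/-- A gliding hump argument: let `g n` converge to zero when tested against bounded measurable
functions. If the integrals of `‖g n‖` over each set of an exhausting sequence are eventually
small, then so are the integrals over the whole space. -/
theorem eventually_integral_norm_le_of_exhaustion {X E : Type*} [MeasurableSpace X]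
    {μ : Measure X} [NormedAddCommGroup E] [InnerProductSpace ℝ E] [MeasurableSpace E]
    [BorelSpace E] [SecondCountableTopology E] {g : ℕ → X → E} (hgm : ∀ n, Measurable (g n))
    (hgi : ∀ n, Integrable (g n) μ)
    (hg : ∀ φ : X → E, Measurable φ → (∀ x, ‖φ x‖ ≤ 1) →
      Tendsto (fun n => ∫ x, (inner ℝ (φ x) (g n x) : ℝ) ∂μ) atTop (𝓝 0))
    {S : ℕ → Set X} (hSm : ∀ K, MeasurableSet (S K)) (hS : Monotone S)
    (hcover : ∀ᵐ x ∂μ, ∃ K, x ∈ S K) {δ : ℝ} (hδ : 0 < δ)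
    (hhead : ∀ K, ∀ᶠ n in atTop, ∫ x in S K, ‖g n x‖ ∂μ ≤ δ) :
    ∀ᶠ n in atTop, ∫ x, ‖g n x‖ ∂μ ≤ 5 * δ := by
  classical
  by_contra hcon
  rw [not_eventually] at hcon
  have htail : ∀ n, Tendsto (fun K => ∫ x in (S K)ᶜ, ‖g n x‖ ∂μ) atTop (𝓝 0) := fun n => by
    have h := tendsto_setIntegral_of_antitone (μ := μ) (f := fun x => ‖g n x‖)
      (fun K => (hSm K).compl) (fun _ _ h => Set.compl_subset_compl.2 (hS h))
      ⟨0, (hgi n).norm.integrableOn⟩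
    have h0 : μ (⋂ K, (S K)ᶜ) = 0 := by
      rw [← Set.compl_iUnion, measure_eq_zero_iff_ae_notMem]
      filter_upwards [hcover] with x hx
      simpa using hx
    rwa [setIntegral_measure_zero _ h0] at h
  -- More than `3 * δ` of the mass of `g n` lies in the annulus `S K' \ S K`.
  have hstep : ∀ K, ∃ n K', K ≤ n ∧ K < K' ∧ 5 * δ < ∫ x, ‖g n x‖ ∂μ ∧
      ∫ x in S K, ‖g n x‖ ∂μ ≤ δ ∧ ∫ x in (S K')ᶜ, ‖g n x‖ ∂μ ≤ δ := fun K => by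
    obtain ⟨n, h1, h2, h3⟩ := (hcon.and_eventually ((hhead K).and (eventually_ge_atTop K))).exists
    obtain ⟨K', h4, h5⟩ :=
      (((htail n).eventually_le_const hδ).and (eventually_gt_atTop K)).exists
    exact ⟨n, K', h3, h5, not_le.1 h1, h2, h4⟩
  choose N K' hKN hKK' hbig hsmall htl using hstep
  let k : ℕ → ℕ := fun i => K'^[i] 0
  have hk_succ : ∀ i, k (i + 1) = K' (k i) := fun i => Function.iterate_succ_apply' _ _ _
  have hk : StrictMono k := strictMono_nat_of_lt_succ fun i => by rw [hk_succ]; exact hKK' _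
  have hN : Tendsto (fun i => N (k i)) atTop atTop :=
    tendsto_atTop_mono (fun i => (hk.id_le i).trans (hKN _)) tendsto_id
  -- The second alternative, on a null set, makes `Nat.find` total.
  have hex : ∀ x, ∃ i, x ∈ S (k (i + 1)) ∨ x ∉ ⋃ K, S K := fun x => by
    by_cases hx : x ∈ ⋃ K, S K
    · obtain ⟨K, hK⟩ := Set.mem_iUnion.1 hx
      exact ⟨K, Or.inl (hS ((Nat.le_succ K).trans (hk.id_le _)) hK)⟩
    · exact ⟨0, Or.inr hx⟩
  let φ : X → E := fun x => ‖g (N (k (Nat.find (hex x)))) x‖⁻¹ • g (N (k (Nat.find (hex x)))) x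
  have hφ : Measurable φ := Measurable.find
    (f := fun i x => ‖g (N (k i)) x‖⁻¹ • g (N (k i)) x)
    (p := fun i x => x ∈ S (k (i + 1)) ∨ x ∉ ⋃ K, S K)
    (fun i => (hgm _).norm.inv.smul (hgm _))
    (fun i => (hSm _).union (MeasurableSet.iUnion hSm).compl) hex
  have hφ1 : ∀ x, ‖φ x‖ ≤ 1 := fun x => by
    simp only [φ, norm_smul, norm_inv, norm_norm]
    exact inv_mul_le_one
  have hlow : ∀ i, δ ≤ ∫ x, (inner ℝ (φ x) (g (N (k i)) x) : ℝ) ∂μ := fun i => by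
    let n := N (k i)
    have hi1 := ((hgi n).norm.indicator (hSm (k i))).const_mul 2
    have hi2 := ((hgi n).norm.indicator (hSm (k (i + 1))).compl).const_mul 2
    have hi0 : Integrable (fun x => ‖g n x‖ - 2 * (S (k i)).indicator (fun x => ‖g n x‖) x) μ :=
      (hgi n).norm.sub hi1
    -- The pairing is `‖g n x‖` on the annulus and at least `-‖g n x‖` elsewhere; hence `5δ - 2δ -
    -- 2δ = δ`.
    have hle : ∫ x, (‖g n x‖ - 2 * (S (k i)).indicator (fun x => ‖g n x‖) x -
        2 * (S (k (i + 1)))ᶜ.indicator (fun x => ‖g n x‖) x) ∂μ ≤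
        ∫ x, (inner ℝ (φ x) (g n x) : ℝ) ∂μ := by
      refine integral_mono_ae (hi0.sub hi2) ((hgi n).inner_of_bounded hφ hφ1) ?_
      filter_upwards [hcover] with x hx
      have hneg : -‖g n x‖ ≤ inner ℝ (φ x) (g n x) := by
        have h1 := neg_le_of_abs_le (abs_real_inner_le_norm (φ x) (g n x))
        have h2 : ‖φ x‖ * ‖g n x‖ ≤ 1 * ‖g n x‖ := by gcongr; exact hφ1 x
        linarith
      have hn0 := norm_nonneg (g n x)
      by_cases h1 : x ∈ S (k i)
      · by_cases h2 : x ∈ (S (k (i + 1)))ᶜ <;>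
          simp only [h1, h2, Set.indicator_of_mem, Set.indicator_of_notMem, not_false_eq_true] <;>
          linarith
      · by_cases h2 : x ∈ (S (k (i + 1)))ᶜ
        · simp only [h1, h2, Set.indicator_of_mem, Set.indicator_of_notMem, not_false_eq_true]
          linarith
        · simp only [h1, h2, Set.indicator_of_notMem, not_false_eq_true]
          have hfind : Nat.find (hex x) = i := by
            rw [Nat.find_eq_iff]
            refine ⟨Or.inl (not_not.1 h2), fun j hj h => ?_⟩
            rcases h with h | h
            · exact h1 (hS (hk.monotone hj) h)
            · exact h (Set.mem_iUnion.2 hx)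
          have hval : (inner ℝ (φ x) (g n x) : ℝ) = ‖g n x‖ := by
            simp only [φ, hfind]
            rw [real_inner_smul_left, real_inner_self_eq_norm_sq]
            by_cases h0 : ‖g n x‖ = 0
            · simp only [n] at h0 ⊢; simp [h0]
            · simp only [n] at h0 ⊢; field_simp
          rw [hval]
          linarith
    rw [integral_sub hi0 hi2, integral_sub (hgi n).norm hi1,
      integral_const_mul, integral_const_mul, integral_indicator (hSm _),
      integral_indicator (hSm _).compl] at hle
    have e1 := hbig (k i)
    have e2 := hsmall (k i)
    have e3 := htl (k i)
    rw [← hk_succ] at e3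
    simp only [n] at hle
    linarith
  exact absurd (ge_of_tendsto ((hg φ hφ hφ1).comp hN) (Eventually.of_forall hlow)) (not_le.2 hδ)

/-! ### Small weights and bounded slopes -/

/-- For countably many integrable functions there is a weight of arbitrarily small integral which
is positive almost everywhere where one of them does not vanish. -/
theorem exists_integrable_weight {X E : Type*} [MeasurableSpace X] {μ : Measure X}
    [NormedAddCommGroup E] [MeasurableSpace E] [BorelSpace E] {g : ℕ → X → E}
    (hgm : ∀ n, Measurable (g n)) (hgi : ∀ n, Integrable (g n) μ) {δ : ℝ} (hδ : 0 < δ) :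
    ∃ w : X → ℝ, Measurable w ∧ Integrable w μ ∧ (∀ x, 0 ≤ w x) ∧ ∫ x, w x ∂μ ≤ δ ∧
      ∀ᵐ x ∂μ, ∀ n, g n x ≠ 0 → 0 < w x := by
  obtain ⟨c, hc, hlt⟩ := ENNReal.exists_pos_tsum_mul_lt_of_countable
    (ENNReal.ofReal_pos.2 hδ).ne' (fun n => ∫⁻ x, ‖g n x‖ₑ ∂μ) fun n => (hgi n).2.ne
  let W : X → ENNReal := fun x => ∑' n, ‖g n x‖ₑ * c n
  have hWm : Measurable W := Measurable.tsum fun n => (hgm n).enorm.mul_const _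
  have hW : ∫⁻ x, W x ∂μ < ENNReal.ofReal δ := by
    rw [lintegral_tsum fun n => ((hgm n).enorm.mul_const _).aemeasurable]
    simpa only [lintegral_mul_const _ (hgm _).enorm] using hlt
  have hWfin : ∀ᵐ x ∂μ, W x < ⊤ := ae_lt_top hWm (hW.trans ENNReal.ofReal_lt_top).ne
  refine ⟨fun x => (W x).toReal, hWm.ennreal_toReal,
    integrable_toReal_of_lintegral_ne_top hWm.aemeasurable (hW.trans ENNReal.ofReal_lt_top).ne,
    fun x => ENNReal.toReal_nonneg, ?_, ?_⟩
  · rw [integral_toReal hWm.aemeasurable hWfin]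
    exact ENNReal.toReal_le_of_le_ofReal hδ.le hW.le
  · filter_upwards [hWfin] with x hx n hn
    refine ENNReal.toReal_pos (fun h => ?_) hx.ne
    have := ENNReal.tsum_eq_zero.1 h n
    simp [hn, (hc n).ne'] at this

/-- If `‖g n‖` is dominated on each of finitely many measurable sets by a fixed function plus a
continuous linear form of `g n`, then it is so on their union, with a bounded slope. -/
theorem exists_bounded_slope_on_biUnion {X E : Type*} [MeasurableSpace X]
    [NormedAddCommGroup E] [InnerProductSpace ℝ E] [MeasurableSpace E] {g : ℕ → X → E}
    {w : X → ℝ} {p : ℕ → E} {A : ℕ → Set X} (hAm : ∀ k, MeasurableSet (A k))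
    (hA : ∀ k, ∀ x ∈ A k, ∀ n, ‖g n x‖ ≤ w x + inner ℝ (p k) (g n x)) (K : ℕ) :
    ∃ (P : X → E) (C : ℝ), Measurable P ∧ (∀ x, ‖P x‖ ≤ C) ∧
      (∀ x ∉ ⋃ k < K, A k, P x = 0) ∧
      ∀ x ∈ ⋃ k < K, A k, ∀ n, ‖g n x‖ ≤ w x + inner ℝ (P x) (g n x) := by
  classical
  induction K with
  | zero => exact ⟨0, 0, measurable_const, by simp, by simp, by simp⟩
  | succ K ih =>
    obtain ⟨P, C, hPm, hPC, hP0, hP⟩ := ih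
    refine ⟨(A K).piecewise (fun _ => p K) P, max C ‖p K‖,
      measurable_const.piecewise (hAm K) hPm, fun x => ?_, fun x hx => ?_, fun x hx n => ?_⟩
    · by_cases h : x ∈ A K
      · simp [h]
      · simp [h, hPC x]
    · rw [Set.biUnion_lt_succ] at hx
      rw [Set.mem_union, not_or] at hx
      rw [Set.piecewise_eq_of_notMem _ _ _ hx.2, hP0 x hx.1]
    · by_cases h : x ∈ A K
      · rw [Set.piecewise_eq_of_mem _ _ _ h]
        exact hA K x h n
      · rw [Set.piecewise_eq_of_notMem _ _ _ h]
        rw [Set.biUnion_lt_succ] at hx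
        exact hP x (hx.resolve_right h) n

theorem theoremA6 {X : Type*} [MeasurableSpace X] (μ : Measure X) (m : ℕ)
    (F : X → Set (EuclideanSpace ℝ (Fin m)))
    (hF_meas : MeasurableSetValued F)
    (hF_nonempty : ∀ x, (F x).Nonempty)
    (hF_compact : ∀ x, IsCompact (F x))
    (hF_convex : ∀ x, Convex ℝ (F x))
    (f : Lp (EuclideanSpace ℝ (Fin m)) 1 μ)
    (hf : ∀ᵐ x ∂μ, f x ∈ Set.extremePoints ℝ (F x))
    (fseq : ℕ → Lp (EuclideanSpace ℝ (Fin m)) 1 μ)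
    (hfseq : ∀ n, ∀ᵐ x ∂μ, fseq n x ∈ F x)
    (hweak : Tendsto
      (fun n => toWeakSpace ℝ (Lp (EuclideanSpace ℝ (Fin m)) 1 μ) (fseq n)) atTop
      (𝓝 (toWeakSpace ℝ (Lp (EuclideanSpace ℝ (Fin m)) 1 μ) f))) :
    Tendsto fseq atTop (𝓝 f) := by
  let g : ℕ → X → EuclideanSpace ℝ (Fin m) := fun n x => fseq n x - f x
  have hgm : ∀ n, Measurable (g n) := fun n =>
    (Lp.stronglyMeasurable (fseq n)).measurable.sub (Lp.stronglyMeasurable f).measurable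
  have hgi : ∀ n, Integrable (g n) μ := fun n =>
    (L1.integrable_coeFn (fseq n)).sub (L1.integrable_coeFn f)
  have htest : ∀ (φ : X → EuclideanSpace ℝ (Fin m)) (C : ℝ), Measurable φ → (∀ x, ‖φ x‖ ≤ C) →
      Tendsto (fun n => ∫ x, (inner ℝ (φ x) (g n x) : ℝ) ∂μ) atTop (𝓝 0) := fun φ C hφ hC =>
    tendsto_integral_inner_sub_of_tendsto_toWeakSpace hweak hφ hC
  have key : ∀ δ : ℝ, 0 < δ → ∀ᶠ n in atTop, ∫ x, ‖g n x‖ ∂μ ≤ 5 * (2 * δ) := fun δ hδ => by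
    obtain ⟨w, hwm, hwi, hw0, hwδ, hwpos⟩ := exists_integrable_weight hgm hgi hδ
    obtain ⟨p, hp⟩ := TopologicalSpace.exists_dense_seq (EuclideanSpace ℝ (Fin m))
    -- Testing only the countably many values `g n x` makes `A k` measurable without a measurable
    -- selection.
    let A : ℕ → Set X := fun k => {x | ∀ n, ‖g n x‖ ≤ w x + inner ℝ (p k) (g n x)}
    have hAm : ∀ k, MeasurableSet (A k) := fun k => by
      simp only [A, Set.ofPred_forall]
      exact MeasurableSet.iInter fun n => measurableSet_le (hgm n).norm
        (hwm.add (measurable_const.inner (hgm n)))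
    have hSm : ∀ K : ℕ, MeasurableSet (⋃ k < K, A k) := fun K =>
      MeasurableSet.iUnion fun k => MeasurableSet.iUnion fun _ => hAm k
    refine eventually_integral_norm_le_of_exhaustion hgm hgi (fun φ h1 h2 => htest φ 1 h1 h2)
      (S := fun K => ⋃ k < K, A k) hSm
      (fun K L hKL => Set.biUnion_subset_biUnion_left fun k hk => lt_of_lt_of_le hk hKL) ?_
      (by positivity) fun K => ?_
    · filter_upwards [hf, ae_all_iff.2 hfseq, hwpos] with x hx hxn hxw
      suffices h : ∃ k, x ∈ A k by
        obtain ⟨k, hk⟩ := h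
        exact ⟨k + 1, Set.mem_iUnion₂.2 ⟨k, Nat.lt_succ_self k, hk⟩⟩
      by_cases h : ∃ n, g n x ≠ 0
      · obtain ⟨n, hn⟩ := h
        obtain ⟨k, hk⟩ := exists_norm_sub_le_add_inner_of_denseRange (hF_compact x) (hF_convex x)
          hx (hxw n hn) hp
        exact ⟨k, fun n => hk _ (hxn n)⟩
      -- Here `w x` may vanish, but any slope works.
      · push Not at h
        exact ⟨0, fun n => by simp [h n, hw0 x]⟩
    · obtain ⟨P, C, hPm, hPC, hP0, hP⟩ :=
        exists_bounded_slope_on_biUnion (g := g) hAm (fun k x hx => hx) K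
      filter_upwards [(htest P C hPm hPC).eventually_le_const hδ] with n hn
      calc ∫ x in ⋃ k < K, A k, ‖g n x‖ ∂μ
          = ∫ x, (⋃ k < K, A k).indicator (fun x => ‖g n x‖) x ∂μ :=
            (integral_indicator (hSm K)).symm
        _ ≤ ∫ x, (w x + inner ℝ (P x) (g n x)) ∂μ := by
            refine integral_mono ((hgi n).norm.indicator (hSm K))
              (hwi.add ((hgi n).inner_of_bounded hPm hPC)) fun x => ?_
            by_cases h : x ∈ ⋃ k < K, A k
            · simpa only [Set.indicator_of_mem h] using hP x h n
            · simpa only [Set.indicator_of_notMem h, hP0 x h, inner_zero_left, add_zero]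
                using hw0 x
        _ = ∫ x, w x ∂μ + ∫ x, (inner ℝ (P x) (g n x) : ℝ) ∂μ :=
            integral_add hwi ((hgi n).inner_of_bounded hPm hPC)
        _ ≤ 2 * δ := by linarith
  rw [Metric.tendsto_atTop']
  intro ε hε
  -- `5 * (2 * (ε / 20)) = ε / 2`, which leaves strict room below `ε`.
  obtain ⟨N, hN⟩ := eventually_atTop.1 (key (ε / 20) (by positivity))
  refine ⟨N, fun n hn => ?_⟩
  have hnorm : dist (fseq n) f = ∫ x, ‖g n x‖ ∂μ := by
    rw [dist_eq_norm, L1.norm_eq_integral_norm]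
    refine integral_congr_ae ?_
    filter_upwards [Lp.coeFn_sub (fseq n) f] with x hx
    rw [hx, Pi.sub_apply]
  have := hN n (le_of_lt hn)
  rw [hnorm]
  linarith
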